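/- A Heyting semilattice is a set $H$ with a constant $1$ and binary operations $\wedge$, $\Rightarrow$ such that $1\wedge x=x$, $x\wedge x=x$, $x\wedge y=y\wedge x$, $x\wedge(y\wedge z)=(x\wedge y)\wedge z$, $(x\Rightarrow x)=1$, $x\wedge(x\Rightarrow y)=x\wedge y$, $y\wedge(x\Rightarrow y)=y$ and $(x\Rightarrow (y\wedge z))=(x\Rightarrow y)\wedge(x\Rightarrow z)$. Let $\mathsf{HSLat}$ be the (semi-abelian) category of Heyting semilattices and maps preserving $1,\wedge,\Rightarrow$. In a semi-abelian category, for subobjects $x_i\colon X_i\rightarrowtail A$ ($1\le i\le n$), the Higgins commutator $[X_1,\dots,X_n]\le A$ is the regular image, under $\langle x_1,\dots,x_n\rangle\colon X_1+\dots+X_n\to A$, of the kernel of the canonical morphism $$X_1+\dots+X_n\longrightarrow\prod_{k=1}^n\ \coprod_{j\neq k}X_j$$ whose $k$-th component restricts on $X_l$ to the coproduct inclusion if $l\ne k$ and to $0$ if $l=k$. (For $n=2$ this morphism is, up to the order of the factors, the canonical $X_1+X_2\to X_1\times X_2$.) The category satisfies condition (W) if for all objects $A$ and all subobjects $X,Y,Z\le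 A$, $[X,Y]=0$ implies $[X,Y,Z]=0$. **Corollary.** The category $\mathsf{HSLat}$ does not satisfy (W). It does not satisfy it in terms of weights either: it is not true that for all subobjects $x\colon X\rightarrowtail A$, $y\colon Y\rightarrowtail A$, $w\colon W\rightarrowtail A$ in $\mathsf{HSLat}$, if $x$ and $y$ Huq-commute (there is $\varphi\colon X\times Y\to A$ with $\varphi\circ(1_X,0)=x$ and $\varphi\circ(0,1_Y)=y$), then $x$ and $y$ commute over the weight $w$ (there is $\varphi\colon (W+X)\times_W(W+Y)\to A$, where the pullback is that of the retractions $\langle 1_W,0\rangle$, restricting to $\langle w,x\rangle$ on $W+X$ and to $\langle w,y\rangle$ on $W+Y$ along the sections induced by the inclusions of $W$). -/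

import Mathlib

set_option linter.unusedVariables false
set_option linter.unusedSectionVars false

open CategoryTheory CategoryTheory.Limits

universe u v

/-! ## Heyting semilattices -/

/-- A Heyting semilattice `(H, ⊤, ⊓, ⇨)`, presented by equations. -/
class HeytingSemilattice (H : Type u) extends Top H, Min H, HImp H where
  top_inf : ∀ x : H, ⊤ ⊓ x = x
  inf_self : ∀ x : H, x ⊓ x = x
  inf_comm : ∀ x y : H, x ⊓ y = y ⊓ x
  inf_assoc : ∀ x y z : H, x ⊓ (y ⊓ z) = (x ⊓ y) ⊓ z
  himp_self : ∀ x : H, (x ⇨ x) = ⊤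
  inf_himp : ∀ x y : H, x ⊓ (x ⇨ y) = x ⊓ y
  inf_himp_right : ∀ x y : H, y ⊓ (x ⇨ y) = y
  himp_inf : ∀ x y z : H, (x ⇨ (y ⊓ z)) = (x ⇨ y) ⊓ (x ⇨ z)

/-- Morphisms of Heyting semilattices preserve the constant and both operations. -/
@[ext]
structure HeytingSemilatticeHom (A B : Type u) [HeytingSemilattice A] [HeytingSemilattice B] where
  toFun : A → B
  map_top : toFun ⊤ = ⊤
  map_inf : ∀ x y, toFun (x ⊓ y) = toFun x ⊓ toFun y
  map_himp : ∀ x y, toFun (x ⇨ y) = (toFun x ⇨ toFun y)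

instance {A B : Type u} [HeytingSemilattice A] [HeytingSemilattice B] :
    FunLike (HeytingSemilatticeHom A B) A B where
  coe := HeytingSemilatticeHom.toFun
  coe_injective _ _ h := HeytingSemilatticeHom.ext h

/-- The category of Heyting semilattices (in the universe `u`). -/
structure HSLat : Type (u + 1) where
  of ::
  carrier : Type u
  [str : HeytingSemilattice carrier]

namespace HSLat

attribute [instance] HSLat.str

instance : CoeSort HSLat.{u} (Type u) := ⟨HSLat.carrier⟩

instance : Category.{u} HSLat.{u} where
  Hom A B := HeytingSemilatticeHom A B
  id A := ⟨id, rfl, fun _ _ => rfl, fun _ _ => rfl⟩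
  comp f g :=
    { toFun := fun x => g.toFun (f.toFun x)
      map_top := by rw [f.map_top, g.map_top]
      map_inf := fun x y => by rw [f.map_inf, g.map_inf]
      map_himp := fun x y => by rw [f.map_himp, g.map_himp] }

instance : ConcreteCategory.{u} HSLat.{u} (fun A B => HeytingSemilatticeHom A B) where
  hom f := f
  ofHom f := f

theorem map_top {A B : HSLat.{u}} (f : A ⟶ B) : f ⊤ = ⊤ := HeytingSemilatticeHom.map_top f

theorem map_inf {A B : HSLat.{u}} (f : A ⟶ B) (x y : A) : f (x ⊓ y) = f x ⊓ f y :=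
  HeytingSemilatticeHom.map_inf f x y

theorem map_himp {A B : HSLat.{u}} (f : A ⟶ B) (x y : A) : f (x ⇨ y) = (f x ⇨ f y) :=
  HeytingSemilatticeHom.map_himp f x y

/-! ### The category of Heyting semilattices is pointed -/

instance : HasZeroMorphisms HSLat.{u} where
  zero A B := ⟨{
    toFun := fun _ => ⊤
    map_top := rfl
    map_inf := fun _ _ => (HeytingSemilattice.top_inf _).symm
    map_himp := fun _ _ => (HeytingSemilattice.himp_self _).symm }⟩
  comp_zero _ _ := rfl
  zero_comp _ _ _ f := HeytingSemilatticeHom.ext (funext fun _ => map_top f)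

theorem zero_apply {A B : HSLat.{u}} (x : A) : (0 : A ⟶ B) x = ⊤ := rfl

instance : HeytingSemilattice PUnit.{u + 1} where
  top := ⟨⟩
  min _ _ := ⟨⟩
  himp _ _ := ⟨⟩
  top_inf _ := rfl
  inf_self _ := rfl
  inf_comm _ _ := rfl
  inf_assoc _ _ _ := rfl
  himp_self _ := rfl
  inf_himp _ _ := rfl
  inf_himp_right _ _ := rfl
  himp_inf _ _ _ := rfl

instance : HasZeroObject HSLat.{u} where
  zero := ⟨of PUnit.{u + 1}, (IsZero.iff_id_eq_zero _).2 rfl⟩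

/-! ### Limits -/

instance {J : Type u} (A : J → HSLat.{u}) : HeytingSemilattice (∀ j, A j) where
  top _ := ⊤
  min x y j := x j ⊓ y j
  himp x y j := x j ⇨ y j
  top_inf _ := funext fun _ => HeytingSemilattice.top_inf _
  inf_self _ := funext fun _ => HeytingSemilattice.inf_self _
  inf_comm _ _ := funext fun _ => HeytingSemilattice.inf_comm _ _
  inf_assoc _ _ _ := funext fun _ => HeytingSemilattice.inf_assoc _ _ _
  himp_self _ := funext fun _ => HeytingSemilattice.himp_self _
  inf_himp _ _ := funext fun _ => HeytingSemilattice.inf_himp _ _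
  inf_himp_right _ _ := funext fun _ => HeytingSemilattice.inf_himp_right _ _
  himp_inf _ _ _ := funext fun _ => HeytingSemilattice.himp_inf _ _ _

/-- The product of a family, with its projections. -/
def piFan {J : Type u} (A : J → HSLat.{u}) : Fan A :=
  Fan.mk (of (∀ j, A j)) fun j =>
    { toFun := fun x => x j
      map_top := rfl
      map_inf := fun _ _ => rfl
      map_himp := fun _ _ => rfl }

instance : HasProducts.{u} HSLat.{u} :=
  hasProducts_of_limit_fans (fun A => piFan A) fun A =>
    Fan.IsLimit.mk _
      (fun s =>
        { toFun := fun x j => s.proj j x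
          map_top := funext fun _ => map_top _
          map_inf := fun _ _ => funext fun _ => map_inf _ _ _
          map_himp := fun _ _ => funext fun _ => map_himp _ _ _ })
      (fun _ _ => rfl)
      (fun s m h => HeytingSemilatticeHom.ext (funext fun x => funext fun j =>
        congrFun (congrArg HeytingSemilatticeHom.toFun (h j)) x))

instance : HasFiniteProducts HSLat.{u} := hasFiniteProducts_of_hasProducts.{u} _

/-- The subalgebra of `A` on a subset that is closed under the operations. -/
@[reducible]
def sub (A : HSLat.{u}) (P : A → Prop) (ht : P ⊤) (hi : ∀ x y, P x → P y → P (x ⊓ y))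
    (hh : ∀ x y, P x → P y → P (x ⇨ y)) : HeytingSemilattice {x : A // P x} where
  top := ⟨⊤, ht⟩
  min x y := ⟨x.1 ⊓ y.1, hi _ _ x.2 y.2⟩
  himp x y := ⟨x.1 ⇨ y.1, hh _ _ x.2 y.2⟩
  top_inf _ := Subtype.ext (HeytingSemilattice.top_inf _)
  inf_self _ := Subtype.ext (HeytingSemilattice.inf_self _)
  inf_comm _ _ := Subtype.ext (HeytingSemilattice.inf_comm _ _)
  inf_assoc _ _ _ := Subtype.ext (HeytingSemilattice.inf_assoc _ _ _)
  himp_self _ := Subtype.ext (HeytingSemilattice.himp_self _)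
  inf_himp _ _ := Subtype.ext (HeytingSemilattice.inf_himp _ _)
  inf_himp_right _ _ := Subtype.ext (HeytingSemilattice.inf_himp_right _ _)
  himp_inf _ _ _ := Subtype.ext (HeytingSemilattice.himp_inf _ _ _)

/-- The equaliser of two morphisms, as a subalgebra. -/
def eqObj {A B : HSLat.{u}} (f g : A ⟶ B) : HSLat.{u} :=
  @of {x : A // f x = g x} (sub A (fun x => f x = g x) (by rw [map_top, map_top])
    (fun x y hx hy => by rw [map_inf, map_inf, hx, hy])
    (fun x y hx hy => by rw [map_himp, map_himp, hx, hy]))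

/-- The inclusion of the equaliser. -/
def eqι {A B : HSLat.{u}} (f g : A ⟶ B) : eqObj f g ⟶ A where
  toFun := Subtype.val
  map_top := rfl
  map_inf _ _ := rfl
  map_himp _ _ := rfl

theorem eqι_condition {A B : HSLat.{u}} (f g : A ⟶ B) : eqι f g ≫ f = eqι f g ≫ g :=
  HeytingSemilatticeHom.ext (funext fun x => x.2)

instance : HasEqualizers HSLat.{u} :=
  @hasEqualizers_of_hasLimit_parallelPair _ _ fun {A B} {f g} =>
    HasLimit.mk
      { cone := Fork.ofι (eqι f g) (eqι_condition f g)
        isLimit := Fork.IsLimit.mk _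
          (fun s =>
            { toFun := fun x => ⟨s.ι x,
                congrFun (congrArg HeytingSemilatticeHom.toFun s.condition) x⟩
              map_top := Subtype.ext (map_top _)
              map_inf := fun _ _ => Subtype.ext (map_inf _ _ _)
              map_himp := fun _ _ => Subtype.ext (map_himp _ _ _) })
          (fun _ => rfl)
          (fun s m h => HeytingSemilatticeHom.ext (funext fun x => Subtype.ext
            (congrFun (congrArg HeytingSemilatticeHom.toFun h) x))) }

instance : HasFiniteLimits HSLat.{u} := hasFiniteLimits_of_hasEqualizers_and_finite_products

/-! ### Coproducts -/

section Coproducts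

variable {J : Type u} (A : J → HSLat.{u})

/-- Formal words in the elements of a family of Heyting semilattices. -/
inductive Word : Type u
  | incl (j : J) (x : A j) : Word
  | top : Word
  | inf (s t : Word) : Word
  | imp (s t : Word) : Word

/-- The congruence on words that is generated by the axioms of Heyting semilattices and by the
requirement that the inclusions be morphisms. -/
inductive Word.Rel : Word A → Word A → Prop
  | refl (s) : Rel s s
  | symm {s t} : Rel s t → Rel t s
  | trans {s t r} : Rel s t → Rel t r → Rel s r
  | inf_congr {s s' t t'} : Rel s s' → Rel t t' → Rel (.inf s t) (.inf s' t')
  | imp_congr {s s' t t'} : Rel s s' → Rel t t' → Rel (.imp s t) (.imp s' t')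
  | incl_top (j) : Rel (.incl j ⊤) .top
  | incl_inf (j) (x y : A j) : Rel (.incl j (x ⊓ y)) (.inf (.incl j x) (.incl j y))
  | incl_imp (j) (x y : A j) : Rel (.incl j (x ⇨ y)) (.imp (.incl j x) (.incl j y))
  | top_inf (s) : Rel (.inf .top s) s
  | inf_self (s) : Rel (.inf s s) s
  | inf_comm (s t) : Rel (.inf s t) (.inf t s)
  | inf_assoc (s t r) : Rel (.inf s (.inf t r)) (.inf (.inf s t) r)
  | himp_self (s) : Rel (.imp s s) .top
  | inf_himp (s t) : Rel (.inf s (.imp s t)) (.inf s t)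
  | inf_himp_right (s t) : Rel (.inf t (.imp s t)) t
  | himp_inf (s t r) : Rel (.imp s (.inf t r)) (.inf (.imp s t) (.imp s r))

/-- The setoid of the congruence above. -/
def Word.setoid : Setoid (Word A) := ⟨Word.Rel A, .refl, .symm, .trans⟩

/-- The underlying set of the coproduct: words modulo the congruence. -/
def CoprodCarrier : Type u := Quotient (Word.setoid A)

instance : HeytingSemilattice (CoprodCarrier A) where
  top := Quotient.mk (Word.setoid A) .top
  min := Quotient.map₂ .inf fun _ _ h _ _ h' => .inf_congr h h'
  himp := Quotient.map₂ .imp fun _ _ h _ _ h' => .imp_congr h h'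
  top_inf := by rintro ⟨s⟩; exact Quotient.sound (.top_inf s)
  inf_self := by rintro ⟨s⟩; exact Quotient.sound (.inf_self s)
  inf_comm := by rintro ⟨s⟩ ⟨t⟩; exact Quotient.sound (.inf_comm s t)
  inf_assoc := by rintro ⟨s⟩ ⟨t⟩ ⟨r⟩; exact Quotient.sound (.inf_assoc s t r)
  himp_self := by rintro ⟨s⟩; exact Quotient.sound (.himp_self s)
  inf_himp := by rintro ⟨s⟩ ⟨t⟩; exact Quotient.sound (.inf_himp s t)
  inf_himp_right := by rintro ⟨s⟩ ⟨t⟩; exact Quotient.sound (.inf_himp_right s t)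
  himp_inf := by rintro ⟨s⟩ ⟨t⟩ ⟨r⟩; exact Quotient.sound (.himp_inf s t r)

/-- The coproduct of a family, with its inclusions. -/
def coprodCofan : Cofan A :=
  Cofan.mk (of (CoprodCarrier A)) fun j =>
    { toFun := fun x => Quotient.mk (Word.setoid A) (.incl j x)
      map_top := Quotient.sound (.incl_top j)
      map_inf := fun x y => Quotient.sound (.incl_inf j x y)
      map_himp := fun x y => Quotient.sound (.incl_imp j x y) }

variable {A}

/-- Evaluation of words in a Heyting semilattice. -/
def Word.eval {B : HSLat.{u}} (f : ∀ j, A j ⟶ B) : Word A → B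
  | .incl j x => f j x
  | .top => ⊤
  | .inf s t => Word.eval f s ⊓ Word.eval f t
  | .imp s t => Word.eval f s ⇨ Word.eval f t

theorem Word.eval_rel {B : HSLat.{u}} (f : ∀ j, A j ⟶ B) {s t : Word A} (h : Word.Rel A s t) :
    Word.eval f s = Word.eval f t := by
  induction h with
  | refl => rfl
  | symm _ ih => exact ih.symm
  | trans _ _ ih ih' => exact ih.trans ih'
  | inf_congr _ _ ih ih' => simp only [Word.eval, ih, ih']
  | imp_congr _ _ ih ih' => simp only [Word.eval, ih, ih']
  | incl_top j => exact map_top (f j)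
  | incl_inf j x y => exact map_inf (f j) x y
  | incl_imp j x y => exact map_himp (f j) x y
  | top_inf => exact HeytingSemilattice.top_inf _
  | inf_self => exact HeytingSemilattice.inf_self _
  | inf_comm => exact HeytingSemilattice.inf_comm _ _
  | inf_assoc => exact HeytingSemilattice.inf_assoc _ _ _
  | himp_self => exact HeytingSemilattice.himp_self _
  | inf_himp => exact HeytingSemilattice.inf_himp _ _
  | inf_himp_right => exact HeytingSemilattice.inf_himp_right _ _
  | himp_inf => exact HeytingSemilattice.himp_inf _ _ _

/-- The morphism out of the coproduct that a family of morphisms induces. -/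
def coprodDesc {B : HSLat.{u}} (f : ∀ j, A j ⟶ B) : of (CoprodCarrier A) ⟶ B where
  toFun := Quotient.lift (Word.eval f) fun _ _ h => Word.eval_rel f h
  map_top := rfl
  map_inf := by rintro ⟨s⟩ ⟨t⟩; rfl
  map_himp := by rintro ⟨s⟩ ⟨t⟩; rfl

theorem coprodDesc_uniq {B : HSLat.{u}} (f : ∀ j, A j ⟶ B) (m : of (CoprodCarrier A) ⟶ B)
    (h : ∀ j, (coprodCofan A).inj j ≫ m = f j) : m = coprodDesc f := by
  refine HeytingSemilatticeHom.ext (funext ?_)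
  rintro ⟨s⟩
  induction s with
  | incl j x => exact congrFun (congrArg HeytingSemilatticeHom.toFun (h j)) x
  | top => exact map_top m
  | inf s t ihs iht =>
    refine (map_inf m (Quotient.mk (Word.setoid A) s) (Quotient.mk (Word.setoid A) t)).trans ?_
    exact congrArg₂ (· ⊓ ·) ihs iht
  | imp s t ihs iht =>
    refine (map_himp m (Quotient.mk (Word.setoid A) s) (Quotient.mk (Word.setoid A) t)).trans ?_
    exact congrArg₂ (· ⇨ ·) ihs iht

end Coproducts

instance : HasCoproducts.{u} HSLat.{u} :=
  hasCoproducts_of_colimit_cofans (fun A => coprodCofan A) fun A =>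
    Cofan.IsColimit.mk _ (fun s => coprodDesc s.inj) (fun _ _ => rfl)
      (fun s m h => coprodDesc_uniq s.inj m h)

instance : HasFiniteCoproducts HSLat.{u} := hasFiniteCoproducts_of_hasCoproducts.{u} _

/-! ### Regularity -/

/-- The image of a morphism, as a subalgebra. -/
def rangeObj {A B : HSLat.{u}} (f : A ⟶ B) : HSLat.{u} :=
  @of {y : B // ∃ x : A, f x = y} (sub B (fun y => ∃ x : A, f x = y) ⟨⊤, map_top f⟩
    (by rintro _ _ ⟨x, rfl⟩ ⟨y, rfl⟩; exact ⟨x ⊓ y, map_inf f x y⟩)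
    (by rintro _ _ ⟨x, rfl⟩ ⟨y, rfl⟩; exact ⟨x ⇨ y, map_himp f x y⟩))

/-- The inclusion of the image. -/
def rangeι {A B : HSLat.{u}} (f : A ⟶ B) : rangeObj f ⟶ B where
  toFun := Subtype.val
  map_top := rfl
  map_inf _ _ := rfl
  map_himp _ _ := rfl

/-- The corestriction of a morphism to its image. -/
def toRange {A B : HSLat.{u}} (f : A ⟶ B) : A ⟶ rangeObj f where
  toFun x := ⟨f x, x, rfl⟩
  map_top := Subtype.ext (map_top f)
  map_inf x y := Subtype.ext (map_inf f x y)
  map_himp x y := Subtype.ext (map_himp f x y)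

theorem toRange_surjective {A B : HSLat.{u}} (f : A ⟶ B) : Function.Surjective (toRange f) := by
  rintro ⟨_, x, rfl⟩
  exact ⟨x, rfl⟩

instance {A B : HSLat.{u}} (f : A ⟶ B) : Mono (rangeι f) where
  right_cancellation g h e := HeytingSemilatticeHom.ext (funext fun x => Subtype.ext
    (congrFun (congrArg HeytingSemilatticeHom.toFun e) x))

/-- A morphism that is constant on the fibres of a surjective one factors through it. -/
noncomputable def surjDesc {A B C : HSLat.{u}} (q : A ⟶ B) (hq : Function.Surjective q) (k : A ⟶ C)
    (h : ∀ a b, q a = q b → k a = k b) : B ⟶ C where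
  toFun y := k (Function.surjInv hq y)
  map_top := by
    rw [← map_top k]; apply h; rw [Function.surjInv_eq hq, map_top]
  map_inf x y := by
    rw [← map_inf k]; apply h; rw [Function.surjInv_eq hq, map_inf, Function.surjInv_eq hq,
      Function.surjInv_eq hq]
  map_himp x y := by
    rw [← map_himp k]; apply h; rw [Function.surjInv_eq hq, map_himp, Function.surjInv_eq hq,
      Function.surjInv_eq hq]

/-- A surjective morphism is the coequaliser of any pair that generates its fibres. -/
noncomputable def surjIsColimit {W A B : HSLat.{u}} (g₁ g₂ : W ⟶ A) (q : A ⟶ B)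
    (w : g₁ ≫ q = g₂ ≫ q) (hq : Function.Surjective q)
    (h : ∀ a b, q a = q b → ∃ z, g₁ z = a ∧ g₂ z = b) : IsColimit (Cofork.ofπ q w) :=
  Cofork.IsColimit.mk _
    (fun s => surjDesc q hq s.π (by
      intro a b hab
      obtain ⟨z, rfl, rfl⟩ := h a b hab
      exact congrFun (congrArg HeytingSemilatticeHom.toFun s.condition) z))
    (fun s => HeytingSemilatticeHom.ext (funext fun x => by
      have key : ∀ a b, q a = q b → s.π a = s.π b := by
        intro a b hab
        obtain ⟨z, rfl, rfl⟩ := h a b hab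
        exact congrFun (congrArg HeytingSemilatticeHom.toFun s.condition) z
      exact key _ _ (Function.surjInv_eq hq _)))
    (fun s m hm => HeytingSemilatticeHom.ext (funext fun y => by
      have := congrFun (congrArg HeytingSemilatticeHom.toFun hm) (Function.surjInv hq y)
      refine Eq.trans ?_ this
      exact congrArg (fun t => m t) (Function.surjInv_eq hq y).symm))

/-- Elements of a pullback. -/
theorem exists_of_isPullback {P A B C : HSLat.{u}} {p₁ : P ⟶ A} {p₂ : P ⟶ B} {f : A ⟶ C}
    {g : B ⟶ C} (hP : IsPullback p₁ p₂ f g) (a : A) (b : B) (hab : f a = g b) :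
    ∃ z, p₁ z = a ∧ p₂ z = b := by
  let i : HeytingSemilattice (A × B) :=
    { top_inf := fun _ => Prod.ext (HeytingSemilattice.top_inf _) (HeytingSemilattice.top_inf _)
      inf_self := fun _ => Prod.ext (HeytingSemilattice.inf_self _) (HeytingSemilattice.inf_self _)
      inf_comm := fun _ _ =>
        Prod.ext (HeytingSemilattice.inf_comm _ _) (HeytingSemilattice.inf_comm _ _)
      inf_assoc := fun _ _ _ =>
        Prod.ext (HeytingSemilattice.inf_assoc _ _ _) (HeytingSemilattice.inf_assoc _ _ _)
      himp_self := fun _ =>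
        Prod.ext (HeytingSemilattice.himp_self _) (HeytingSemilattice.himp_self _)
      inf_himp := fun _ _ =>
        Prod.ext (HeytingSemilattice.inf_himp _ _) (HeytingSemilattice.inf_himp _ _)
      inf_himp_right := fun _ _ =>
        Prod.ext (HeytingSemilattice.inf_himp_right _ _) (HeytingSemilattice.inf_himp_right _ _)
      himp_inf := fun _ _ _ =>
        Prod.ext (HeytingSemilattice.himp_inf _ _ _) (HeytingSemilattice.himp_inf _ _ _) }
  let π₁ : of (A × B) ⟶ A := ⟨Prod.fst, rfl, fun _ _ => rfl, fun _ _ => rfl⟩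
  let π₂ : of (A × B) ⟶ B := ⟨Prod.snd, rfl, fun _ _ => rfl, fun _ _ => rfl⟩
  have e := eqι_condition (π₁ ≫ f) (π₂ ≫ g)
  let l := hP.lift (eqι (π₁ ≫ f) (π₂ ≫ g) ≫ π₁) (eqι (π₁ ≫ f) (π₂ ≫ g) ≫ π₂) (by simpa using e)
  let t : eqObj (π₁ ≫ f) (π₂ ≫ g) := (⟨(a, b), hab⟩ : {x : A × B // f x.1 = g x.2})
  refine ⟨l t, ?_, ?_⟩
  · exact congrFun (congrArg HeytingSemilatticeHom.toFun (hP.lift_fst _ _ _)) t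
  · exact congrFun (congrArg HeytingSemilatticeHom.toFun (hP.lift_snd _ _ _)) t

theorem isRegularEpi_of_surjective {A B : HSLat.{u}} (q : A ⟶ B) (hq : Function.Surjective q) :
    IsRegularEpi q :=
  ⟨⟨{ W := _
      left := pullback.fst q q
      right := pullback.snd q q
      w := pullback.condition
      isColimit := surjIsColimit _ _ q _ hq
        (exists_of_isPullback (IsPullback.of_hasPullback q q)) }⟩⟩

theorem surjective_of_isRegularEpi {A B : HSLat.{u}} (q : A ⟶ B) [IsRegularEpi q] :
    Function.Surjective q := by
  have : StrongEpi q := inferInstance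
  have h : IsIso (rangeι q) := ExtremalEpi.isIso (f := q) (toRange q) (rangeι q) rfl
  intro y
  obtain ⟨x, hx⟩ := (inv (rangeι q) y).2
  refine ⟨x, hx.trans ?_⟩
  exact congrFun (congrArg HeytingSemilatticeHom.toFun (IsIso.inv_hom_id (rangeι q))) y

instance : Regular HSLat.{u} where
  hasCoequalizer_of_isKernelPair {A B Z f g₁ g₂} h :=
    HasColimit.mk
      { cocone := Cofork.ofπ (toRange f) (HeytingSemilatticeHom.ext (funext fun z =>
          Subtype.ext (congrFun (congrArg HeytingSemilatticeHom.toFun h.w) z)))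
        isColimit := surjIsColimit _ _ _ _ (toRange_surjective f) fun a b hab =>
          exists_of_isPullback h a b (congrArg Subtype.val hab) }
  regularEpiIsStableUnderBaseChange :=
    { of_isPullback := fun {X Y Y' S f g f' g'} hP hg => by
        have : IsRegularEpi g := hg
        refine isRegularEpi_of_surjective _ fun y => ?_
        obtain ⟨x, hx⟩ := surjective_of_isRegularEpi g (f y)
        obtain ⟨z, -, hz⟩ := exists_of_isPullback hP x y hx
        exact ⟨z, hz⟩ }

end HSLat

/-! ## Commutators and the condition (W)

Everything below makes sense in a pointed regular category with finite coproducts, in particular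
in any semi-abelian category. -/

section Commutators

variable {C : Type u} [Category.{v} C] [Regular C] [HasZeroMorphisms C] [HasZeroObject C]
  [HasFiniteCoproducts C]

/-- The canonical morphism `X + Y ⟶ X × Y`. -/
noncomputable def cosmashMap₂ (X Y : C) : X ⨿ Y ⟶ X ⨯ Y :=
  coprod.desc (prod.lift (𝟙 X) 0) (prod.lift 0 (𝟙 Y))

/-- The binary Higgins commutator `[X, Y]`: the regular image in `A` of the binary cosmash product
`X ⋄ Y = Ker (X + Y ⟶ X × Y)`. (In a regular category, images are regular images.) -/
noncomputable def higgins₂ {A : C} (X Y : Subobject A) : Subobject A :=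
  imageSubobject (kernel.ι (cosmashMap₂ (X : C) (Y : C)) ≫ coprod.desc X.arrow Y.arrow)

/-- The canonical morphism from the coproduct of `n` objects to the product, over all `k`, of the
coproducts of all of them but the `k`-th. It maps `X l` to the `k`-th factor by the inclusion
if `l ≠ k`, and by zero if `l = k`. -/
noncomputable def cosmashMap {n : ℕ} (X : Fin n → C) :
    ∐ X ⟶ ∏ᶜ fun k : Fin n => ∐ fun j : {j : Fin n // j ≠ k} => X j.1 :=
  Sigma.desc fun l => Pi.lift fun k =>
    if h : l ≠ k then Sigma.ι (fun j : {j : Fin n // j ≠ k} => X j.1) ⟨l, h⟩ else 0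

/-- The `n`-ary Higgins commutator `[X₁, …, Xₙ]`: the regular image in `A` of the `n`-ary cosmash
product, the kernel of `cosmashMap`. -/
noncomputable def higgins {n : ℕ} {A : C} (X : Fin n → Subobject A) : Subobject A :=
  imageSubobject (kernel.ι (cosmashMap fun i => (X i : C)) ≫ Sigma.desc fun i => (X i).arrow)

/-- Two morphisms Huq-commute if they admit a cooperator `φ : X × Y ⟶ A`. -/
def HuqCommute {X Y A : C} (x : X ⟶ A) (y : Y ⟶ A) : Prop :=
  ∃ φ : X ⨯ Y ⟶ A, prod.lift (𝟙 X) 0 ≫ φ = x ∧ prod.lift 0 (𝟙 Y) ≫ φ = y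

/-- The retraction `W + X ⟶ W` of the coproduct inclusion, which is zero on `X`. -/
noncomputable def weightRetraction (W X : C) : W ⨿ X ⟶ W :=
  coprod.desc (𝟙 W) 0

theorem inl_weightRetraction (W X : C) : coprod.inl ≫ weightRetraction W X = 𝟙 W :=
  coprod.inl_desc _ _

/-- Two morphisms `x` and `y` commute over the weight `w : W ⟶ A` if there is a morphism
`φ : (W + X) ×_W (W + Y) ⟶ A` that restricts to `⟨w, x⟩` on `W + X` and to `⟨w, y⟩` on `W + Y`,
along the sections of the two projections of the pullback which are induced by the inclusions of
`W` in `W + Y` and in `W + X`, respectively. -/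
def CommuteOver {X Y W A : C} (x : X ⟶ A) (y : Y ⟶ A) (w : W ⟶ A) : Prop :=
  ∃ φ : pullback (weightRetraction W X) (weightRetraction W Y) ⟶ A,
    pullback.lift (𝟙 (W ⨿ X)) (weightRetraction W X ≫ coprod.inl)
      (by simp [inl_weightRetraction]) ≫ φ = coprod.desc w x ∧
    pullback.lift (weightRetraction W Y ≫ coprod.inl) (𝟙 (W ⨿ Y))
      (by simp [inl_weightRetraction]) ≫ φ = coprod.desc w y

variable (C)

/-- The condition (W), in terms of Higgins commutators: `[X, Y] = 0` implies `[X, Y, Z] = 0`. -/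
def ConditionW : Prop :=
  ∀ (A : C) (X Y Z : Subobject A), higgins₂ X Y = ⊥ → higgins ![X, Y, Z] = ⊥

/-- The condition (W), in terms of weights: commutation of subobjects does not depend on the
weight, that is, subobjects that Huq-commute also commute over every weight. -/
def WeightedConditionW : Prop :=
  ∀ (A : C) (X Y Z : Subobject A),
    HuqCommute X.arrow Y.arrow → CommuteOver X.arrow Y.arrow Z.arrow

end Commutators

/-! One Heyting semilattice refutes both conditions: the four-element Boolean algebra with a new
top, with `X = {left, ⊤}`, `Y = {right, ⊤}` and weight `{join, ⊤}`. Since `left` and `right` are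
each other's pseudocomplement, `{bot, left, right, ⊤}` is a subalgebra isomorphic to `X × Y`, so `X`
and `Y` Huq-commute and `[X, Y] = 0`. The element `join` lies outside that subalgebra, and a third
argument makes it visible.

For Higgins commutators, the term `((x ⇨ z) ⊓ (y ⇨ z)) ⇨ z` becomes `⊤` as soon as any one variable
is set to `⊤`, so its values lie in `[X, Y, Z]` (`eq_top_of_higgins_eq_bot`). At `left`, `right`,
`join` its value is `join`, not `⊤`.

For weights, `(x ⇨ w) ⇨ w` and `(y ⇨ w) ⇨ w` are killed by the retractions onto `W`, so they sit in
complementary coordinates of the pullback, where `(a, ⊤) ⇨ (⊤, b) = (⊤, b)`. A morphism on the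
pullback preserves this identity (`himp_eq_of_commuteOver`). Here both terms equal `join`, and `join
⇨ join = ⊤` differs from `join`. -/

namespace HeytingSemilattice

/-! ### Identities in Heyting semilattices -/

variable {H : Type u} [HeytingSemilattice H]

theorem top_himp (x : H) : (⊤ ⇨ x) = x := by
  rw [← top_inf (⊤ ⇨ x), inf_himp, top_inf]

theorem himp_top (x : H) : (x ⇨ ⊤) = ⊤ := by
  rw [← top_inf (x ⇨ ⊤), inf_himp_right]

theorem eq_top_of_inf_eq_top {x y : H} (h : x ⊓ y = ⊤) : x = ⊤ := by
  rw [← top_inf x, inf_comm, ← h, inf_assoc, inf_self]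

theorem inf_himp_left (x y : H) : (x ⊓ y ⇨ x) = ⊤ := by
  -- By distributivity the implications from `x ⊓ y` to `x` and to `y` meet in `x ⊓ y ⇨ x ⊓ y`,
  -- which is `⊤`.
  refine eq_top_of_inf_eq_top (y := x ⊓ y ⇨ y) ?_
  rw [← himp_inf, himp_self]

theorem inf_himp_snd (x y : H) : (x ⊓ y ⇨ y) = ⊤ := by
  rw [inf_comm, inf_himp_left]

end HeytingSemilattice

/-! ### Elements of pullbacks and of cosmash products -/

namespace HSLat

open HeytingSemilattice

theorem hom_congr {A B : HSLat.{u}} {f g : A ⟶ B} (h : f = g) (x : A) : f x = g x := by rw [h]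

section Sub

variable (A : HSLat.{u}) (P : A → Prop) (ht : P ⊤) (hi : ∀ x y, P x → P y → P (x ⊓ y))
  (hh : ∀ x y, P x → P y → P (x ⇨ y))

/-- The subalgebra on a subset that is closed under the operations, as an object. -/
def subObj : HSLat.{u} := @of {x : A // P x} (sub A P ht hi hh)

/-- The inclusion of a subalgebra. -/
def subι : subObj A P ht hi hh ⟶ A where
  toFun := Subtype.val
  map_top := rfl
  map_inf _ _ := rfl
  map_himp _ _ := rfl

instance : Mono (subι A P ht hi hh) :=
  ⟨fun _ _ e => HeytingSemilatticeHom.ext (funext fun x => Subtype.ext (hom_congr e x))⟩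

end Sub

/-- Elements of a pullback are determined by their components. -/
theorem pullback_ext {A B C : HSLat.{u}} {f : A ⟶ C} {g : B ⟶ C}
    {p q : (pullback f g : HSLat.{u})} (h₁ : pullback.fst f g p = pullback.fst f g q)
    (h₂ : pullback.snd f g p = pullback.snd f g q) : p = q := by
  let k := pullback.fst f g
  -- The pullback is known only by its universal property. The pair `(p, q)` is therefore viewed as
  -- an element of the kernel pair of the first projection, and of the equaliser `e` on which the
  -- second projections agree too; there the two legs coincide as morphisms.
  obtain ⟨z, rfl, rfl⟩ := exists_of_isPullback (IsPullback.of_hasPullback k k) p q h₁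
  let m₁ := pullback.fst k k
  let m₂ := pullback.snd k k
  let e := eqι (m₁ ≫ pullback.snd f g) (m₂ ≫ pullback.snd f g)
  have he : e ≫ m₁ = e ≫ m₂ := by
    apply pullback.hom_ext
    · simp only [Category.assoc]
      exact congrArg (e ≫ ·) pullback.condition
    · simpa only [Category.assoc] using eqι_condition _ _
  exact hom_congr he ⟨z, h₂⟩

/-- An element of a finite coproduct that all components of the canonical morphism send to `⊤`
lies in the cosmash product. -/
theorem exists_kernel_cosmashMap {n : ℕ} (X : Fin n → HSLat.{u}) (t : (∐ X : HSLat.{u}))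
    (h : ∀ k, (cosmashMap X ≫ Pi.π _ k) t = ⊤) :
    ∃ s : (kernel (cosmashMap X) : HSLat.{u}), kernel.ι (cosmashMap X) s = t := by
  -- The elements killed by every component form a subalgebra, and its inclusion lifts to the
  -- kernel.
  let i := subι (∐ X) (fun t => ∀ k, (cosmashMap X ≫ Pi.π _ k) t = ⊤) (fun k => map_top _)
    (fun x y hx hy k => by rw [map_inf, hx, hy, top_inf])
    (fun x y hx hy k => by rw [map_himp, hx, hy, HeytingSemilattice.himp_self])
  have hi : i ≫ cosmashMap X = 0 := by
    refine Pi.hom_ext _ _ fun k => ?_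
    rw [Category.assoc, zero_comp]
    exact HeytingSemilatticeHom.ext (funext fun x => x.2 k)
  let t' : {t : (∐ X : HSLat.{u}) // ∀ k, (cosmashMap X ≫ Pi.π _ k) t = ⊤} := ⟨t, h⟩
  exact ⟨kernel.lift _ i hi t', hom_congr (kernel.lift_ι _ i hi) t'⟩

theorem ι_cosmashMap_π_self {n : ℕ} (X : Fin n → HSLat.{u}) (k : Fin n) (x : X k) :
    (cosmashMap X ≫ Pi.π _ k) (Sigma.ι X k x) = ⊤ := by
  have h : Sigma.ι X k ≫ cosmashMap X ≫ Pi.π _ k = 0 := by simp [cosmashMap]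
  exact hom_congr h x

/-! ### Identities forced by commutation conditions -/

/-- The relative join `((x ⇨ z) ⊓ (y ⇨ z)) ⇨ z` belongs to the ternary Higgins commutator. -/
theorem eq_top_of_higgins_eq_bot {A : HSLat.{u}} {X Y Z : Subobject A}
    (h : higgins ![X, Y, Z] = ⊥) (x : (X : HSLat.{u})) (y : (Y : HSLat.{u}))
    (z : (Z : HSLat.{u})) :
    (((X.arrow x ⇨ Z.arrow z) ⊓ (Y.arrow y ⇨ Z.arrow z)) ⇨ Z.arrow z) = ⊤ := by
  let F : Fin 3 → HSLat.{u} := fun i => ((![X, Y, Z] i : Subobject A) : HSLat.{u})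
  let d : ∐ F ⟶ A := Sigma.desc fun i => (![X, Y, Z] i).arrow
  have h0 : kernel.ι (cosmashMap F) ≫ d = 0 := by
    have h' : imageSubobject (kernel.ι (cosmashMap F) ≫ d) = ⊥ := h
    rw [← imageSubobject_arrow_comp (kernel.ι (cosmashMap F) ≫ d)]
    have h'' : (imageSubobject (kernel.ι (cosmashMap F) ≫ d)).arrow = 0 := by
      rw [h']; exact Subobject.bot_arrow
    rw [h'', comp_zero]
  let x' : (∐ F : HSLat.{u}) := Sigma.ι F 0 x
  let y' : (∐ F : HSLat.{u}) := Sigma.ι F 1 y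
  let z' : (∐ F : HSLat.{u}) := Sigma.ι F 2 z
  obtain ⟨s, hs⟩ := exists_kernel_cosmashMap F (((x' ⇨ z') ⊓ (y' ⇨ z')) ⇨ z') (by
    intro k
    simp only [map_himp, map_inf]
    -- Killing `x'` or `y'` turns one premise into `z'` itself, so the implication holds trivially;
    -- killing `z'` makes its conclusion `⊤`.
    fin_cases k
    · have e := ι_cosmashMap_π_self F 0 x
      change (cosmashMap F ≫ Pi.π _ 0) x' = ⊤ at e
      simp only [Fin.zero_eta, e, HeytingSemilattice.top_himp, inf_himp_left]
    · have e := ι_cosmashMap_π_self F 1 y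
      change (cosmashMap F ≫ Pi.π _ 1) y' = ⊤ at e
      simp only [Fin.mk_one, e, HeytingSemilattice.top_himp, inf_himp_snd]
    · have e := ι_cosmashMap_π_self F 2 z
      change (cosmashMap F ≫ Pi.π _ 2) z' = ⊤ at e
      simp only [Fin.reduceFinMk, e, HeytingSemilattice.himp_top])
  have hd : d (((x' ⇨ z') ⊓ (y' ⇨ z')) ⇨ z') = ⊤ := by
    rw [← hs]
    exact hom_congr h0 s
  have hx : d x' = X.arrow x := hom_congr (Sigma.ι_desc (fun i => (![X, Y, Z] i).arrow) 0) x
  have hy : d y' = Y.arrow y := hom_congr (Sigma.ι_desc (fun i => (![X, Y, Z] i).arrow) 1) y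
  have hz : d z' = Z.arrow z := hom_congr (Sigma.ι_desc (fun i => (![X, Y, Z] i).arrow) 2) z
  rwa [map_himp, map_inf, map_himp, map_himp, hx, hy, hz] at hd

/-- A cooperator factors `⟨x, y⟩` through `X + Y ⟶ X × Y`, so `⟨x, y⟩` vanishes on the kernel of
that map. -/
theorem higgins₂_eq_bot_of_huqCommute {A : HSLat.{u}} {X Y : Subobject A}
    (h : HuqCommute X.arrow Y.arrow) : higgins₂ X Y = ⊥ := by
  obtain ⟨φ, h₁, h₂⟩ := h
  have e : coprod.desc X.arrow Y.arrow = cosmashMap₂ (X : HSLat.{u}) Y ≫ φ := by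
    ext1 <;> simp [cosmashMap₂, h₁, h₂]
  have e0 : kernel.ι (cosmashMap₂ (X : HSLat.{u}) Y) ≫ coprod.desc X.arrow Y.arrow = 0 := by
    rw [e, kernel.condition_assoc, zero_comp]
  have : ∀ {K : HSLat.{u}} {f : K ⟶ A}, f = 0 → imageSubobject f = ⊥ := by
    rintro K _ rfl
    exact imageSubobject_zero
  exact this e0

/-- If `x` and `y` commute over `w`, then the relative negations `(x ⇨ w) ⇨ w` and `(y ⇨ w) ⇨ w`
imply each other only trivially. -/
theorem himp_eq_of_commuteOver {X Y W A : HSLat.{u}} {x : X ⟶ A} {y : Y ⟶ A} {w : W ⟶ A}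
    (h : CommuteOver x y w) (p : X) (q : Y) (r : W) :
    (((x p ⇨ w r) ⇨ w r) ⇨ ((y q ⇨ w r) ⇨ w r)) = ((y q ⇨ w r) ⇨ w r) := by
  obtain ⟨φ, h₁, h₂⟩ := h
  let i : (W ⨿ X : HSLat.{u}) := coprod.inl (C := HSLat.{u}) r
  let j : (W ⨿ Y : HSLat.{u}) := coprod.inl (C := HSLat.{u}) r
  let p' : (W ⨿ X : HSLat.{u}) := coprod.inr (C := HSLat.{u}) p
  let q' : (W ⨿ Y : HSLat.{u}) := coprod.inr (C := HSLat.{u}) q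
  -- Replacing `p'` or `q'` by `⊤` leaves an element implying itself, so both terms lie in the
  -- kernels of the retractions.
  let a := (p' ⇨ i) ⇨ i
  let b := (q' ⇨ j) ⇨ j
  have hp : weightRetraction W X p' = ⊤ :=
    hom_congr (coprod.inr_desc (𝟙 W) (0 : X ⟶ W)) p
  have hq : weightRetraction W Y q' = ⊤ :=
    hom_congr (coprod.inr_desc (𝟙 W) (0 : Y ⟶ W)) q
  have ha : weightRetraction W X a = ⊤ := by
    simp only [a, map_himp, hp, HeytingSemilattice.top_himp, HeytingSemilattice.himp_self]
  have hb : weightRetraction W Y b = ⊤ := by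
    simp only [b, map_himp, hq, HeytingSemilattice.top_himp, HeytingSemilattice.himp_self]
  have c₁ : pullback.lift (𝟙 (W ⨿ X)) (weightRetraction W X ≫ coprod.inl)
      (by simp [inl_weightRetraction]) ≫ pullback.fst (weightRetraction W X)
        (weightRetraction W Y) = 𝟙 _ := pullback.lift_fst _ _ _
  have c₂ : pullback.lift (𝟙 (W ⨿ X)) (weightRetraction W X ≫ coprod.inl)
      (by simp [inl_weightRetraction]) ≫ pullback.snd (weightRetraction W X)
        (weightRetraction W Y) = weightRetraction W X ≫ coprod.inl := pullback.lift_snd _ _ _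
  have c₃ : pullback.lift (weightRetraction W Y ≫ coprod.inl) (𝟙 (W ⨿ Y))
      (by simp [inl_weightRetraction]) ≫ pullback.fst (weightRetraction W X)
        (weightRetraction W Y) = weightRetraction W Y ≫ coprod.inl := pullback.lift_fst _ _ _
  have c₄ : pullback.lift (weightRetraction W Y ≫ coprod.inl) (𝟙 (W ⨿ Y))
      (by simp [inl_weightRetraction]) ≫ pullback.snd (weightRetraction W X)
        (weightRetraction W Y) = 𝟙 _ := pullback.lift_snd _ _ _
  set s := pullback.lift (𝟙 (W ⨿ X)) (weightRetraction W X ≫ coprod.inl)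
    (by simp [inl_weightRetraction] :
      𝟙 (W ⨿ X) ≫ weightRetraction W X = _ ≫ weightRetraction W Y)
  set t := pullback.lift (weightRetraction W Y ≫ coprod.inl) (𝟙 (W ⨿ Y))
    (by simp [inl_weightRetraction] :
      _ ≫ weightRetraction W X = 𝟙 (W ⨿ Y) ≫ weightRetraction W Y)
  have e₁ : pullback.fst (weightRetraction W X) (weightRetraction W Y) (t b) = ⊤ :=
    (hom_congr c₃ b).trans ((congrArg _ hb).trans (map_top (coprod.inl : W ⟶ W ⨿ X)))
  have e₂ : pullback.snd (weightRetraction W X) (weightRetraction W Y) (s a) = ⊤ :=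
    (hom_congr c₂ a).trans ((congrArg _ ha).trans (map_top (coprod.inl : W ⟶ W ⨿ Y)))
  -- In coordinates, `s a = (a, ⊤)` and `t b = (⊤, b)`.
  have key : (s a ⇨ t b) = t b := by
    apply pullback_ext
    · rw [map_himp, e₁, HeytingSemilattice.himp_top]
    · rw [map_himp, e₂, HeytingSemilattice.top_himp]
  have fa : φ (s a) = ((x p ⇨ w r) ⇨ w r) := by
    refine (hom_congr h₁ a).trans ?_
    have hi : coprod.desc w x i = w r := hom_congr (coprod.inl_desc w x) r
    have hp : coprod.desc w x p' = x p := hom_congr (coprod.inr_desc w x) p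
    simp only [a, map_himp, hi, hp]
  have fb : φ (t b) = ((y q ⇨ w r) ⇨ w r) := by
    refine (hom_congr h₂ b).trans ?_
    have hj : coprod.desc w y j = w r := hom_congr (coprod.inl_desc w y) r
    have hq : coprod.desc w y q' = y q := hom_congr (coprod.inr_desc w y) q
    simp only [b, map_himp, hj, hq]
  have := congrArg (fun v => φ v) key
  simpa only [map_himp, fa, fb] using this

/-! ### The four-element Boolean algebra with a new top element -/

/-- The four-element Boolean algebra `{bot, left, right, join}` with a new element `top` on top. -/
inductive Diamond : Type u
  | bot | left | right | join | top

namespace Diamond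

/-- The meet. -/
def meet : Diamond.{u} → Diamond.{u} → Diamond.{u}
  | top, y => y
  | x, top => x
  | join, y => y
  | x, join => x
  | left, left => left
  | right, right => right
  | _, _ => bot

/-- The relative pseudocomplement. -/
def arrow : Diamond.{u} → Diamond.{u} → Diamond.{u}
  | top, y => y
  | _, top => top
  | bot, _ => top
  | _, join => top
  | join, y => y
  | left, left => top
  -- Only `bot` and `right` remain as second argument.
  | left, _ => right
  | right, right => top
  | right, _ => left

instance : HeytingSemilattice Diamond.{u} where
  top := top
  min := meet
  himp := arrow
  top_inf x := by cases x <;> rfl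
  inf_self x := by cases x <;> rfl
  inf_comm x y := by cases x <;> cases y <;> rfl
  inf_assoc x y z := by cases x <;> cases y <;> cases z <;> rfl
  himp_self x := by cases x <;> rfl
  inf_himp x y := by cases x <;> cases y <;> rfl
  inf_himp_right x y := by cases x <;> cases y <;> rfl
  himp_inf x y z := by cases x <;> cases y <;> cases z <;> rfl

end Diamond

/-! ### Two-element subalgebras and a cooperator -/

/-- The inclusion of the subalgebra `{a, ⊤}`. -/
def pairι {A : HSLat.{u}} (a : A) : subObj A (fun x => x = a ∨ x = ⊤) (Or.inr rfl)
    (by rintro _ _ (rfl | rfl) (rfl | rfl) <;> simp [top_inf, inf_self, inf_comm _ (⊤ : A)])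
    (by rintro _ _ (rfl | rfl) (rfl | rfl) <;> simp [HeytingSemilattice.top_himp,
      HeytingSemilattice.himp_top, HeytingSemilattice.himp_self]) ⟶ A :=
  subι A _ _ _ _

instance {A : HSLat.{u}} (a : A) : Mono (pairι a) := inferInstanceAs (Mono (subι A _ _ _ _))

/-- The subalgebra `{a, ⊤}`. -/
noncomputable def pair {A : HSLat.{u}} (a : A) : Subobject A := Subobject.mk (pairι a)

/-- The object underlying a `Subobject` is only isomorphic to the chosen subalgebra, so membership
has to be carried across `Subobject.underlyingIso`. -/
theorem pair_arrow_apply {A : HSLat.{u}} (a : A) (p : (pair a : HSLat.{u})) :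
    (pair a).arrow p = a ∨ (pair a).arrow p = ⊤ := by
  have h := hom_congr (Subobject.underlyingIso_hom_comp_eq_mk (pairι a)) p
  have h' : pairι a ((Subobject.underlyingIso (pairι a)).hom p) = a ∨
    pairι a ((Subobject.underlyingIso (pairι a)).hom p) = ⊤ :=
    Subtype.property (p := fun x => x = a ∨ x = ⊤) ((Subobject.underlyingIso (pairι a)).hom p)
  have e : pairι a ((Subobject.underlyingIso (pairι a)).hom p) = (pair a).arrow p := h
  rwa [e] at h'

theorem exists_pair_arrow_eq {A : HSLat.{u}} (a : A) :
    ∃ p : (pair a : HSLat.{u}), (pair a).arrow p = a :=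
  let a' : {x : A // x = a ∨ x = ⊤} := ⟨a, Or.inl rfl⟩
  ⟨(Subobject.underlyingIso (pairι a)).inv a',
    hom_congr (Subobject.underlyingIso_arrow (pairι a)) a'⟩

/-- The cooperator is the meet `(p, q) ↦ p ⊓ q`. It preserves implication because `left ⇨ bot = left
⇨ right = right`, and symmetrically. -/
theorem huqCommute_left_right :
    HuqCommute (A := of Diamond.{u}) (pair (A := of Diamond.{u}) Diamond.left).arrow
      (pair (A := of Diamond.{u}) Diamond.right).arrow := by
  let A : HSLat.{u} := of Diamond.{u}
  let x := (pair (A := A) Diamond.left).arrow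
  let y := (pair (A := A) Diamond.right).arrow
  let f := (prod.fst : (pair (A := A) Diamond.left : HSLat.{u}) ⨯
    (pair (A := A) Diamond.right : HSLat.{u}) ⟶ _) ≫ x
  let g := (prod.snd : (pair (A := A) Diamond.left : HSLat.{u}) ⨯
    (pair (A := A) Diamond.right : HSLat.{u}) ⟶ _) ≫ y
  have hf : ∀ p, f p = Diamond.left ∨ f p = Diamond.top := fun p => pair_arrow_apply _ _
  have hg : ∀ p, g p = Diamond.right ∨ g p = Diamond.top := fun p => pair_arrow_apply _ _
  let φ : (pair (A := A) Diamond.left : HSLat.{u}) ⨯ (pair (A := A) Diamond.right : HSLat.{u}) ⟶ A :=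
    { toFun p := f p ⊓ g p
      map_top := by rw [map_top, map_top, top_inf]
      map_inf p q := by
        rw [map_inf, map_inf]
        rcases hf p with h₁ | h₁ <;> rcases hf q with h₂ | h₂ <;> rcases hg p with h₃ | h₃ <;>
          rcases hg q with h₄ | h₄ <;> rw [h₁, h₂, h₃, h₄] <;> rfl
      map_himp p q := by
        rw [map_himp, map_himp]
        rcases hf p with h₁ | h₁ <;> rcases hf q with h₂ | h₂ <;> rcases hg p with h₃ | h₃ <;>
          rcases hg q with h₄ | h₄ <;> rw [h₁, h₂, h₃, h₄] <;> rfl }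
  refine ⟨φ, ?_, ?_⟩ <;> refine HeytingSemilatticeHom.ext (funext fun p => ?_)
  · have e₁ : prod.lift (𝟙 _) 0 ≫ f = x :=
      (prod.lift_fst_assoc _ _ x).trans (Category.id_comp x)
    have e₂ : prod.lift (𝟙 _) 0 ≫ g = 0 :=
      (prod.lift_snd_assoc _ _ y).trans zero_comp
    refine (congrArg₂ (· ⊓ ·) (hom_congr e₁ p) (hom_congr e₂ p)).trans ?_
    exact (HeytingSemilattice.inf_comm _ _).trans (top_inf _)
  · have e₁ : prod.lift 0 (𝟙 _) ≫ f = 0 :=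
      (prod.lift_fst_assoc _ _ x).trans zero_comp
    have e₂ : prod.lift 0 (𝟙 _) ≫ g = y :=
      (prod.lift_snd_assoc _ _ y).trans (Category.id_comp y)
    refine (congrArg₂ (· ⊓ ·) (hom_congr e₁ p) (hom_congr e₂ p)).trans ?_
    exact top_inf _

end HSLat

/-! ### The counterexample -/

theorem mainTheorem3 :
    ¬ ConditionW HSLat.{u} ∧ ¬ WeightedConditionW HSLat.{u} := by
  let A : HSLat.{u} := HSLat.of HSLat.Diamond.{u}
  obtain ⟨x, hx⟩ := HSLat.exists_pair_arrow_eq (A := A) HSLat.Diamond.left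
  obtain ⟨y, hy⟩ := HSLat.exists_pair_arrow_eq (A := A) HSLat.Diamond.right
  obtain ⟨z, hz⟩ := HSLat.exists_pair_arrow_eq (A := A) HSLat.Diamond.join
  constructor
  · intro h
    have := HSLat.eq_top_of_higgins_eq_bot
      (h A _ _ (HSLat.pair (A := A) HSLat.Diamond.join)
        (HSLat.higgins₂_eq_bot_of_huqCommute HSLat.huqCommute_left_right)) x y z
    rw [hx, hy, hz] at this
    -- Both `left ⇨ join` and `right ⇨ join` are `top`, so `this` reduces to `join = top`.
    exact HSLat.Diamond.noConfusion this
  · intro h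
    have := HSLat.himp_eq_of_commuteOver
      (h A _ _ (HSLat.pair (A := A) HSLat.Diamond.join) HSLat.huqCommute_left_right) x y z
    rw [hx, hy, hz] at this
    -- Both relative double negations equal `join`, so `this` reduces to `top = join`.
    exact HSLat.Diamond.noConfusion this
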